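/- **Theorem (Decomposition of algebraically weakly exact pfd bimodules).** Let $\mathbf{k}$ be a field, let $X, Y \subseteq \mathbb{R}$ be finite subsets, and equip $X \times Y$ with the product order. A *persistence module* $M$ over $X\times Y$ consists of $\mathbf{k}$-vector spaces $M_t$ ($t \in X \times Y$) and linear maps $\rho_s^t : M_s \to M_t$ for $s \le t$, such that $\rho_s^s = \mathrm{id}$ and $\rho_t^u \circ \rho_s^t = \rho_s^u$ for all $s \le t \le u$. It is *pointwise finite-dimensional (pfd)* if every $M_t$ is finite-dimensional. Isomorphisms of persistence modules are families of linear isomorphisms commuting with the structure maps, and direct sums are taken pointwise. A *rectangle* of $X \times Y$ is a set $R = I \times J$ where $I \subseteq X$ and $J \subseteq Y$ are nonempty intervals (nonempty convex subsets of $X$ and of $Y$). The *rectangle module* $\mathbf{k}_R$ is the persistence module with $(\mathbf{k}_R)_t = \mathbf{k}$ for $t \in R$ and $(\mathbf{k}_R)_t = 0$ for $t \notin R$, whose map from $s$ to $t$ (for $s\le t$) is $\mathrm{id}_{\mathbf{k}}$ if $s, t \in R$ and $0$ otherwise. Let $M$ be a pfd persistence module over $X \times Y$ that is *algebraically weakly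 exact*, that is, for all $s = (s_x, s_y) \le t = (t_x, t_y)$ in $X \times Y$, $$\operatorname{Im} \rho_s^t = \operatorname{Im} \rho_{(t_x,s_y)}^t \cap \operatorname{Im} \rho_{(s_x,t_y)}^t, \qquad \operatorname{Ker} \rho_s^t = \operatorname{Ker} \rho_s^{(t_x,s_y)} + \operatorname{Ker} \rho_s^{(s_x,t_y)}.$$ Then there is a unique (finite) multiset $\mathcal{R}$ of rectangles of $X \times Y$ such that $$M \cong \bigoplus_{R \in \mathcal{R}} \mathbf{k}_R .$$ -/

import Mathlib

open scoped DirectSum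

universe u v v' w

/-- A persistence module over a preordered set `P` with coefficients in the field `k`: vector
spaces `M_t` and linear maps `ρ_s^t : M_s → M_t` for `s ≤ t`, with `ρ_s^s = id` and
`ρ_t^r ∘ ρ_s^t = ρ_s^r`. -/
structure PersistenceModule (k : Type u) [Field k] (P : Type w) [Preorder P] where
  obj : P → Type v
  [instAddCommGroup : ∀ t, AddCommGroup (obj t)]
  [instModule : ∀ t, Module k (obj t)]
  map : ∀ {s t : P}, s ≤ t → (obj s →ₗ[k] obj t)
  map_refl : ∀ t : P, map (le_refl t) = LinearMap.id
  map_comp : ∀ {s t r : P} (hst : s ≤ t) (htr : t ≤ r),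
    map htr ∘ₗ map hst = map (hst.trans htr)

namespace PersistenceModule

attribute [instance] instAddCommGroup instModule

section General

variable {k : Type u} [Field k] {P : Type w} [Preorder P]

/-- Pointwise finite-dimensional persistence modules. -/
def IsPFD (M : PersistenceModule.{u, v, w} k P) : Prop :=
  ∀ t : P, FiniteDimensional k (M.obj t)

/-- `M ≅ N`: there are linear isomorphisms `M_t ≅ N_t` commuting with the structure maps. -/
def IsIsomorphic (M : PersistenceModule.{u, v, w} k P) (N : PersistenceModule.{u, v', w} k P) :
    Prop :=
  ∃ e : ∀ t : P, M.obj t ≃ₗ[k] N.obj t,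
    ∀ {s t : P} (h : s ≤ t) (x : M.obj s), e t (M.map h x) = N.map h (e s x)

/-- The direct sum of a family of persistence modules, defined pointwise. -/
noncomputable def directSum {ι : Type*} (M : ι → PersistenceModule.{u, v, w} k P) :
    PersistenceModule k P where
  obj t := ⨁ i, (M i).obj t
  map h := DirectSum.lmap fun i => (M i).map h
  map_refl t := by
    ext i x : 2
    simp [map_refl]
  map_comp hst htr := by
    ext i x : 2
    simp [← map_comp (M _) hst htr]

variable (k) in
open Classical in
/-- The indicator module `k_Q` of a convex subset `Q`: it is `k` on `Q` and `0` off `Q` (as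
subspaces of `k`), the map from `s` to `t` is the identity of `k` if `s, t ∈ Q`, and is `0`
otherwise. -/
noncomputable def indicator (Q : Set P) (hQ : Q.OrdConnected) :
    PersistenceModule.{u, u, w} k P where
  obj t := ↥(if t ∈ Q then ⊤ else ⊥ : Submodule k k)
  map {s t} _ :=
    if h : s ∈ Q ∧ t ∈ Q then
      Submodule.inclusion (by rw [if_pos h.1, if_pos h.2])
    else 0
  map_refl t := by
    by_cases h : t ∈ Q
    · rw [dif_pos ⟨h, h⟩]; rfl
    · rw [dif_neg fun h' => h h'.1]
      refine LinearMap.ext fun x => Subtype.ext ?_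
      have h0 : ∀ y ∈ (if t ∈ Q then ⊤ else ⊥ : Submodule k k), 0 = y := by
        rw [if_neg h]; exact fun y hy => ((Submodule.mem_bot k).1 hy).symm
      exact h0 x.1 x.2
  map_comp {s t r} hst htr := by
    by_cases hs : s ∈ Q
    · by_cases hr : r ∈ Q
      · have ht : t ∈ Q := hQ.out hs hr ⟨hst, htr⟩
        rw [dif_pos ⟨ht, hr⟩, dif_pos ⟨hs, ht⟩, dif_pos ⟨hs, hr⟩]; rfl
      · simp [hr]
    · simp [hs]

end General

section Grid

variable {k : Type u} [Field k] {X Y : Type w} [Preorder X] [Preorder Y]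

/-- Algebraic weak exactness of a persistence module over a product `X × Y`: for all `s ≤ t`,
`Im ρ_s^t = Im ρ_{(t_x,s_y)}^t ∩ Im ρ_{(s_x,t_y)}^t` and
`Ker ρ_s^t = Ker ρ_s^{(t_x,s_y)} + Ker ρ_s^{(s_x,t_y)}`. -/
def IsAlgebraicallyWeaklyExact (M : PersistenceModule.{u, v, w} k (X × Y)) : Prop :=
  ∀ (s t : X × Y) (h : s ≤ t),
    LinearMap.range (M.map h) =
      LinearMap.range (M.map (show ((t.1, s.2) : X × Y) ≤ t from ⟨le_rfl, h.2⟩)) ⊓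
      LinearMap.range (M.map (show ((s.1, t.2) : X × Y) ≤ t from ⟨h.1, le_rfl⟩)) ∧
    LinearMap.ker (M.map h) =
      LinearMap.ker (M.map (show s ≤ ((t.1, s.2) : X × Y) from ⟨h.1, le_rfl⟩)) ⊔
      LinearMap.ker (M.map (show s ≤ ((s.1, t.2) : X × Y) from ⟨le_rfl, h.2⟩))

end Grid

end PersistenceModule

/-- A rectangle of `X × Y` is a product `I × J` of (nonempty) intervals `I ⊆ X` and `J ⊆ Y`. -/
def IsRectangle {X Y : Type w} [LinearOrder X] [LinearOrder Y] (R : Set (X × Y)) : Prop :=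
  ∃ (I : Set X) (J : Set Y), I.Nonempty ∧ I.OrdConnected ∧ J.Nonempty ∧ J.OrdConnected ∧
    R = I ×ˢ J

/-- The type of rectangles of `X × Y`. -/
abbrev Rectangle (X Y : Type w) [LinearOrder X] [LinearOrder Y] : Type w :=
  {R : Set (X × Y) // IsRectangle R}

theorem IsRectangle.ordConnected {X Y : Type w} [LinearOrder X] [LinearOrder Y]
    {R : Set (X × Y)} (hR : IsRectangle R) : R.OrdConnected := by
  obtain ⟨I, J, -, hI, -, hJ, rfl⟩ := hR
  exact ⟨fun a ha b hb c hc =>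
    ⟨hI.out ha.1 hb.1 ⟨hc.1.1, hc.2.1⟩, hJ.out ha.2 hb.2 ⟨hc.1.2, hc.2.2⟩⟩⟩

/-- The rectangle module `k_R`. -/
noncomputable def rectangleModule (k : Type u) [Field k] {X Y : Type w} [LinearOrder X]
    [LinearOrder Y] (R : Rectangle X Y) : PersistenceModule.{u, u, w} k (X × Y) :=
  PersistenceModule.indicator k R.1 R.2.ordConnected

open Classical in
/-- The direct sum `⨁_{R ∈ 𝓡} k_R` over a multiset `𝓡` of rectangles; the index type `𝓡.ToType`
has exactly as many elements over each `R` as the multiplicity of `R` in `𝓡`. -/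
noncomputable def rectangleSum (k : Type u) [Field k] {X Y : Type w} [LinearOrder X]
    [LinearOrder Y] (𝓡 : Multiset (Rectangle X Y)) : PersistenceModule k (X × Y) :=
  PersistenceModule.directSum fun i : 𝓡.ToType => rectangleModule k i.1

/-!
Existence is by induction on the total dimension `∑ t, dim M_t`, splitting off one rectangle
module at a time.

In a finite grid the rectangles are the intervals `[a,b]` of the product order. A copy of
`k_{[a,b]}` is a direct summand of `M` as soon as there are a vector `x ∈ M_a` that dies at every
`t ≥ a` with `t ≰ b`, and a functional `φ` on `M_b` that kills the image of `M_t` for every `t ≤ b`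
with `t ≱ a`, such that `φ (ρ_a^b x) = 1`: the two define morphisms `k_{[a,b]} → M → k_{[a,b]}`
composing to the identity (`homToIndicator_homOfVector`).

To find them, take `a` to be the leftmost point of the support of `M` in the lowest row that meets
it (`exists_corner`). Let `b.1` be the last column that `M_a` reaches by a nonzero map along its
row, and `b.2` the last row that `M_a` reaches by a nonzero map in column `b.1`. If `d` is the next
row, then `ρ_a^{(b.1,d)} = 0`, so `M_a = Ker ρ_a^{(b.1,a.2)} + Ker ρ_a^{(a.1,d)}` by weak
exactness. The first summand dies at `b` and `ρ_a^b ≠ 0`, so some `x` in the second one survives to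
`b`; this is the vector (`exists_vector`). If `c` is the column just before `a.1`, then
`Im ρ_{(b.1,a.2)}^b ∩ Im ρ_{(c,b.2)}^b = Im ρ_{(c,a.2)}^b = 0`, so `ρ_a^b x ∉ Im ρ_{(c,b.2)}^b`, and
a functional separating the two is the required `φ` (`exists_functional`), since the rows below `a`
vanish. (If there is no row `d`, any `x` with `ρ_a^b x ≠ 0` will do; if there is no column `c`, any
`φ` with `φ (ρ_a^b x) = 1`.) The complement of the summand is a retract of `M`, hence weakly exact again
(`IsAlgebraicallyWeaklyExact.ker`).

For uniqueness, the rank of `ρ_a^b` in a direct sum of rectangle modules is the number of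
rectangles containing `[a,b]` (`finrank_range_rectangleSum`). These ranks are isomorphism
invariants, and Möbius inversion recovers the multiset from them
(`Multiset.eq_of_countP_le_eq`).
-/

/-! ### Morphisms, direct sums and kernels of persistence modules -/

namespace PersistenceModule

section Hom

variable {k : Type u} [Field k] {P : Type w} [Preorder P]

/-- Morphisms of persistence modules: families of linear maps commuting with the structure maps. -/
structure Hom (M : PersistenceModule.{u, v, w} k P) (N : PersistenceModule.{u, v', w} k P) where
  app : ∀ t, M.obj t →ₗ[k] N.obj t
  naturality : ∀ {s t : P} (h : s ≤ t) (x : M.obj s), app t (M.map h x) = N.map h (app s x)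

theorem map_map (M : PersistenceModule.{u, v, w} k P) {s t r : P} (hst : s ≤ t) (htr : t ≤ r)
    (x : M.obj s) : M.map htr (M.map hst x) = M.map (hst.trans htr) x := by
  rw [← M.map_comp hst htr, LinearMap.comp_apply]

theorem IsIsomorphic.symm {M : PersistenceModule.{u, v, w} k P}
    {N : PersistenceModule.{u, v', w} k P} (h : M.IsIsomorphic N) : N.IsIsomorphic M := by
  obtain ⟨e, he⟩ := h
  refine ⟨fun t => (e t).symm, fun {s t} hst x => ?_⟩
  rw [LinearEquiv.symm_apply_eq, he, LinearEquiv.apply_symm_apply]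

theorem IsIsomorphic.trans {M : PersistenceModule.{u, v, w} k P}
    {N : PersistenceModule.{u, v', w} k P} {L : PersistenceModule k P}
    (h : M.IsIsomorphic N) (h' : N.IsIsomorphic L) : M.IsIsomorphic L := by
  obtain ⟨e, he⟩ := h
  obtain ⟨f, hf⟩ := h'
  exact ⟨fun t => (e t).trans (f t), fun hst x => by simp [he, hf]⟩

theorem IsIsomorphic.finrank_range_eq {M : PersistenceModule.{u, v, w} k P}
    {N : PersistenceModule.{u, v', w} k P} (h : M.IsIsomorphic N) {s t : P} (hst : s ≤ t) :
    Module.finrank k (LinearMap.range (M.map hst)) =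
      Module.finrank k (LinearMap.range (N.map hst)) := by
  obtain ⟨e, he⟩ := h
  have hr : LinearMap.range (N.map hst) =
      (LinearMap.range (M.map hst)).map (e t : M.obj t →ₗ[k] N.obj t) := by
    ext y
    constructor
    · rintro ⟨x, rfl⟩
      exact ⟨M.map hst ((e s).symm x), ⟨_, rfl⟩, by simp [he]⟩
    · rintro ⟨_, ⟨x, rfl⟩, rfl⟩
      exact ⟨e s x, (he hst x).symm⟩
  rw [hr]
  exact (LinearEquiv.finrank_map_eq (e t) _).symm

theorem IsIsomorphic.isPFD {M : PersistenceModule.{u, v, w} k P}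
    {N : PersistenceModule.{u, v', w} k P} (h : M.IsIsomorphic N) (hM : M.IsPFD) : N.IsPFD := by
  obtain ⟨e, -⟩ := h
  intro t
  have := hM t
  exact Module.Finite.equiv (e t)

/-- The direct sum of two persistence modules. -/
def prod (M : PersistenceModule.{u, v, w} k P) (N : PersistenceModule.{u, v', w} k P) :
    PersistenceModule k P where
  obj t := M.obj t × N.obj t
  map h := (M.map h).prodMap (N.map h)
  map_refl t := by
    ext x <;> simp [map_refl]
  map_comp hst htr := by
    ext x <;> simp [map_map]

theorem IsIsomorphic.prod_right {N : PersistenceModule.{u, v, w} k P}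
    {N' : PersistenceModule.{u, v', w} k P} (M : PersistenceModule k P) (h : N.IsIsomorphic N') :
    (M.prod N).IsIsomorphic (M.prod N') := by
  obtain ⟨e, he⟩ := h
  exact ⟨fun t => LinearEquiv.prodCongr (LinearEquiv.refl k _) (e t),
    fun hst x => Prod.ext rfl (he hst x.2)⟩

theorem finrank_range_prod {M : PersistenceModule.{u, v, w} k P}
    {N : PersistenceModule.{u, v', w} k P} (hM : M.IsPFD) (hN : N.IsPFD) {s t : P} (hst : s ≤ t) :
    Module.finrank k (LinearMap.range ((M.prod N).map hst)) =
      Module.finrank k (LinearMap.range (M.map hst)) +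
        Module.finrank k (LinearMap.range (N.map hst)) := by
  have := hM s
  have := hN s
  have hr : LinearMap.range ((M.prod N).map hst) =
      (LinearMap.range (M.map hst)).prod (LinearMap.range (N.map hst)) :=
    LinearMap.range_prodMap _ _
  rw [hr]
  let e : ↥((LinearMap.range (M.map hst)).prod (LinearMap.range (N.map hst))) ≃ₗ[k]
      LinearMap.range (M.map hst) × LinearMap.range (N.map hst) :=
    { toFun := fun x => (⟨x.1.1, x.2.1⟩, ⟨x.1.2, x.2.2⟩)
      invFun := fun y => ⟨(y.1, y.2), y.1.2, y.2.2⟩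
      map_add' := fun _ _ => rfl
      map_smul' := fun _ _ => rfl }
  exact e.finrank_eq.trans Module.finrank_prod

theorem directSum_reindex {ι κ : Type*} (e : ι ≃ κ) (M : ι → PersistenceModule.{u, v, w} k P) :
    (directSum M).IsIsomorphic (directSum fun j => M (e.symm j)) := by
  refine ⟨fun t => DirectSum.lequivCongrLeft k e, fun hst x => ?_⟩
  refine DFinsupp.ext fun j => ?_
  rfl

theorem directSum_option {ι : Type*} (M : Option ι → PersistenceModule.{u, v, w} k P) :
    (directSum M).IsIsomorphic ((M none).prod (directSum fun i => M (some i))) := by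
  refine ⟨fun t => DirectSum.lequivProdDirectSum k, fun hst x => ?_⟩
  refine Prod.ext rfl (DFinsupp.ext fun j => ?_)
  rfl

/-- The kernel of a morphism, defined pointwise. -/
def ker {M : PersistenceModule.{u, v, w} k P} {N : PersistenceModule.{u, v', w} k P}
    (p : Hom M N) : PersistenceModule.{u, v, w} k P where
  obj t := LinearMap.ker (p.app t)
  map {s t} h := (M.map h).restrict fun x hx => by
    rw [LinearMap.mem_ker] at hx ⊢
    rw [p.naturality, hx, map_zero]
  map_refl t := by
    ext x
    simp [map_refl]
  map_comp hst htr := by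
    ext x
    simp [map_map]

/-- A morphism `i : A → M` with a left inverse `p` exhibits `A` as a direct summand of `M`, with
complement the kernel of `p`. -/
theorem isIsomorphic_prod_ker {A : PersistenceModule.{u, v', w} k P}
    {M : PersistenceModule.{u, v, w} k P} (i : Hom A M) (p : Hom M A)
    (hpi : ∀ t x, p.app t (i.app t x) = x) : M.IsIsomorphic (A.prod (ker p)) := by
  refine IsIsomorphic.symm ⟨fun t => LinearEquiv.ofBijective
    ((i.app t).coprod (LinearMap.ker (p.app t)).subtype) ⟨?_, ?_⟩, fun {s t} hst x => ?_⟩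
  · rw [injective_iff_map_eq_zero]
    rintro ⟨x, y, hy⟩ hxy
    have hx : x = 0 := by
      have h := congrArg (p.app t) hxy
      simpa [hpi, LinearMap.mem_ker.1 hy] using h
    subst hx
    simpa using hxy
  · intro z
    refine ⟨(p.app t z, ⟨z - i.app t (p.app t z), by simp [hpi]⟩), by simp⟩
  · have h := i.naturality hst x.1
    change i.app t (A.map hst x.1) + M.map hst x.2.1 = M.map hst (i.app s x.1 + x.2.1)
    rw [map_add, h]

end Hom

/-! ### Morphisms from and to indicator modules -/

section Indicator

variable {k : Type u} [Field k] {P : Type w} [Preorder P]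

/-- The element of `k` underlying an element of the space `(k_Q)_t ⊆ k`. -/
noncomputable def indicatorVal {Q : Set P} (hQ : Q.OrdConnected) (t : P) :
    (indicator k Q hQ).obj t →ₗ[k] k :=
  Submodule.subtype _

theorem indicatorVal_injective {Q : Set P} (hQ : Q.OrdConnected) (t : P) :
    Function.Injective (indicatorVal (k := k) hQ t) :=
  Subtype.val_injective

/-- A functional that vanishes if `t ∉ Q`, regarded as a linear map to `(k_Q)_t ⊆ k`. -/
noncomputable def toIndicator {Q : Set P} (hQ : Q.OrdConnected) {t : P} {V : Type*}
    [AddCommGroup V] [Module k V] (f : V →ₗ[k] k) (hf : t ∉ Q → ∀ x, f x = 0) :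
    V →ₗ[k] (indicator k Q hQ).obj t :=
  LinearMap.codRestrict _ f fun x => by
    split_ifs with ht
    · exact Submodule.mem_top
    · exact (Submodule.mem_bot k).2 (hf ht x)

theorem indicatorVal_toIndicator {Q : Set P} (hQ : Q.OrdConnected) {t : P} {V : Type*}
    [AddCommGroup V] [Module k V] (f : V →ₗ[k] k) (hf : t ∉ Q → ∀ x, f x = 0) (x : V) :
    indicatorVal hQ t (toIndicator hQ f hf x) = f x :=
  rfl

theorem indicator_obj_eq_zero {Q : Set P} (hQ : Q.OrdConnected) {t : P} (ht : t ∉ Q)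
    (x : (indicator k Q hQ).obj t) : x = 0 := by
  classical
  have h0 : ∀ y ∈ (if t ∈ Q then ⊤ else ⊥ : Submodule k k), y = 0 := by
    rw [if_neg ht]
    exact fun y hy => (Submodule.mem_bot k).1 hy
  refine Subtype.ext (h0 x.1 ?_)
  convert x.2

theorem indicatorVal_map {Q : Set P} (hQ : Q.OrdConnected) {s t : P} (hst : s ≤ t)
    (hs : s ∈ Q) (ht : t ∈ Q) (x : (indicator k Q hQ).obj s) :
    indicatorVal hQ t ((indicator k Q hQ).map hst x) = indicatorVal hQ s x := by
  simp only [indicator]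
  rw [dif_pos ⟨hs, ht⟩]
  rfl

theorem indicator_isPFD {Q : Set P} (hQ : Q.OrdConnected) : (indicator k Q hQ).IsPFD :=
  fun t => Module.Finite.of_injective _ (indicatorVal_injective hQ t)

open Classical in
theorem finrank_range_indicator {Q : Set P} (hQ : Q.OrdConnected) {s t : P} (hst : s ≤ t) :
    Module.finrank k (LinearMap.range ((indicator k Q hQ).map hst)) =
      if s ∈ Q ∧ t ∈ Q then 1 else 0 := by
  split_ifs with h
  · have hsurj : LinearMap.range (indicatorVal (k := k) hQ t ∘ₗ (indicator k Q hQ).map hst) =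
        ⊤ := by
      rw [LinearMap.range_eq_top]
      intro c
      refine ⟨toIndicator hQ LinearMap.id (fun hs => absurd h.1 hs) c, ?_⟩
      rw [LinearMap.comp_apply, indicatorVal_map hQ hst h.1 h.2, indicatorVal_toIndicator,
        LinearMap.id_apply]
    rw [(Submodule.equivMapOfInjective _ (indicatorVal_injective hQ t) _).finrank_eq,
      ← LinearMap.range_comp, hsurj, finrank_top, Module.finrank_self]
  · have h0 : (indicator k Q hQ).map hst = 0 := by
      simp only [indicator]
      exact dif_neg h
    rw [h0, LinearMap.range_zero, finrank_bot]

open Classical in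
/-- The morphism `k_{[a,b]} → M` sending the generator at `a` to a vector `x` that dies
outside `[a,b]`. -/
noncomputable def homOfVector (M : PersistenceModule.{u, v, w} k P) {a b : P} (x : M.obj a)
    (hx : ∀ t (h : a ≤ t), ¬ t ≤ b → M.map h x = 0) :
    Hom (indicator k (Set.Icc a b) Set.ordConnected_Icc) M where
  app t := if h : a ≤ t then
    (LinearMap.toSpanSingleton k _ (M.map h x)) ∘ₗ indicatorVal _ t else 0
  naturality := by
    intro s t hst c
    by_cases hs : s ∈ Set.Icc a b
    · have hat : a ≤ t := hs.1.trans hst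
      rw [dif_pos hat, dif_pos hs.1]
      simp only [LinearMap.comp_apply, LinearMap.toSpanSingleton_apply, map_smul, map_map]
      by_cases ht : t ≤ b
      · rw [indicatorVal_map _ hst hs ⟨hat, ht⟩]
      · rw [hx t hat ht, smul_zero, smul_zero]
    · rw [indicator_obj_eq_zero _ hs c, map_zero, map_zero, map_zero, map_zero]

theorem homOfVector_app_of_le (M : PersistenceModule.{u, v, w} k P) {a b : P} (x : M.obj a)
    (hx : ∀ t (h : a ≤ t), ¬ t ≤ b → M.map h x = 0) {t : P} (h : a ≤ t)
    (c : (indicator k (Set.Icc a b) Set.ordConnected_Icc).obj t) :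
    (homOfVector M x hx).app t c = indicatorVal _ t c • M.map h x := by
  simp only [homOfVector]
  rw [dif_pos h, LinearMap.comp_apply, LinearMap.toSpanSingleton_apply]

open Classical in
/-- The morphism `M → k_{[a,b]}` given at `b` by a linear functional `φ` that vanishes on the
images of the spaces `M_t` with `t` outside `[a,b]`. -/
noncomputable def homToIndicator (M : PersistenceModule.{u, v, w} k P) {a b : P}
    (φ : M.obj b →ₗ[k] k) (hφ : ∀ t (h : t ≤ b), ¬ a ≤ t → ∀ x, φ (M.map h x) = 0) :
    Hom M (indicator k (Set.Icc a b) Set.ordConnected_Icc) where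
  app t := toIndicator _ (if h : t ≤ b then φ ∘ₗ M.map h else 0) fun ht x => by
    split_ifs with h
    · exact hφ t h (fun h' => ht ⟨h', h⟩) x
    · rfl
  naturality := by
    intro s t hst x
    by_cases ht : t ∈ Set.Icc a b
    · have hsb : s ≤ b := hst.trans ht.2
      apply indicatorVal_injective
      rw [indicatorVal_toIndicator, dif_pos ht.2, LinearMap.comp_apply, map_map]
      by_cases hs : a ≤ s
      · rw [indicatorVal_map (Q := Set.Icc a b) _ hst ⟨hs, hsb⟩ ht, indicatorVal_toIndicator,
          dif_pos hsb, LinearMap.comp_apply]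
      · have hs' : s ∉ Set.Icc a b := fun h => hs h.1
        rw [hφ s hsb hs, indicator_obj_eq_zero _ hs' (toIndicator _ _ _ x), map_zero, map_zero]
    · exact (indicator_obj_eq_zero _ ht _).trans (indicator_obj_eq_zero _ ht _).symm

theorem indicatorVal_homToIndicator (M : PersistenceModule.{u, v, w} k P) {a b : P}
    (φ : M.obj b →ₗ[k] k) (hφ : ∀ t (h : t ≤ b), ¬ a ≤ t → ∀ x, φ (M.map h x) = 0) {t : P}
    (h : t ≤ b) (x : M.obj t) :
    indicatorVal _ t ((homToIndicator M φ hφ).app t x) = φ (M.map h x) := by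
  rw [homToIndicator, indicatorVal_toIndicator, dif_pos h, LinearMap.comp_apply]

/-- A vector at `a` and a functional at `b` as in `homOfVector` and `homToIndicator` that pair to
`1` split off a copy of `k_{[a,b]}`. -/
theorem homToIndicator_homOfVector (M : PersistenceModule.{u, v, w} k P) {a b : P} (hab : a ≤ b)
    (x : M.obj a) (hx : ∀ t (h : a ≤ t), ¬ t ≤ b → M.map h x = 0)
    (φ : M.obj b →ₗ[k] k) (hφ : ∀ t (h : t ≤ b), ¬ a ≤ t → ∀ x, φ (M.map h x) = 0)
    (h1 : φ (M.map hab x) = 1) (t : P)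
    (c : (indicator k (Set.Icc a b) Set.ordConnected_Icc).obj t) :
    (homToIndicator M φ hφ).app t ((homOfVector M x hx).app t c) = c := by
  by_cases ht : t ∈ Set.Icc a b
  · apply indicatorVal_injective
    rw [indicatorVal_homToIndicator M φ hφ ht.2, homOfVector_app_of_le M x hx ht.1, map_smul,
      map_smul, map_map, h1, smul_eq_mul, mul_one]
  · exact (indicator_obj_eq_zero _ ht _).trans (indicator_obj_eq_zero _ ht _).symm

end Indicator

/-! ### Weak exactness of retracts -/

section Retract

variable {k : Type u} [Field k] {X Y : Type w} [Preorder X] [Preorder Y]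

/-- Algebraic weak exactness passes to retracts, in particular to direct summands. -/
theorem IsAlgebraicallyWeaklyExact.of_retract {M : PersistenceModule.{u, v, w} k (X × Y)}
    {N : PersistenceModule.{u, v', w} k (X × Y)} (hM : M.IsAlgebraicallyWeaklyExact)
    (i : Hom N M) (q : Hom M N) (hqi : ∀ t x, q.app t (i.app t x) = x) :
    N.IsAlgebraicallyWeaklyExact := by
  intro s t hst
  obtain ⟨him, hker⟩ := hM s t hst
  constructor
  · apply le_antisymm
    · rintro _ ⟨x, rfl⟩
      exact ⟨⟨N.map (show s ≤ (t.1, s.2) from ⟨hst.1, le_rfl⟩) x, map_map ..⟩,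
        ⟨N.map (show s ≤ (s.1, t.2) from ⟨le_rfl, hst.2⟩) x, map_map ..⟩⟩
    · rintro y ⟨⟨x₁, h₁⟩, ⟨x₂, h₂⟩⟩
      have hy : i.app t y ∈ LinearMap.range (M.map hst) := by
        rw [him]
        exact ⟨⟨_, by rw [← i.naturality, h₁]⟩, ⟨_, by rw [← i.naturality, h₂]⟩⟩
      obtain ⟨z, hz⟩ := hy
      exact ⟨q.app s z, by rw [← q.naturality, hz, hqi]⟩
  · apply le_antisymm
    · intro x hx
      have hx' : i.app s x ∈ LinearMap.ker (M.map hst) := by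
        rw [LinearMap.mem_ker] at hx ⊢
        rw [← i.naturality, hx, map_zero]
      rw [hker] at hx'
      obtain ⟨x₁, h₁, x₂, h₂, h⟩ := Submodule.mem_sup.1 hx'
      rw [LinearMap.mem_ker] at h₁ h₂
      refine Submodule.mem_sup.2 ⟨q.app s x₁, ?_, q.app s x₂, ?_, by rw [← map_add, h, hqi]⟩
      · rw [LinearMap.mem_ker, ← q.naturality, h₁, map_zero]
      · rw [LinearMap.mem_ker, ← q.naturality, h₂, map_zero]
    · refine sup_le (fun x hx => ?_) (fun x hx => ?_)
      · rw [LinearMap.mem_ker] at hx ⊢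
        rw [← map_map N (show s ≤ ((t.1, s.2) : X × Y) from ⟨hst.1, le_rfl⟩)
          (show ((t.1, s.2) : X × Y) ≤ t from ⟨le_rfl, hst.2⟩), hx, map_zero]
      · rw [LinearMap.mem_ker] at hx ⊢
        rw [← map_map N (show s ≤ ((s.1, t.2) : X × Y) from ⟨le_rfl, hst.2⟩)
          (show ((s.1, t.2) : X × Y) ≤ t from ⟨hst.1, le_rfl⟩), hx, map_zero]

theorem IsAlgebraicallyWeaklyExact.ker {M : PersistenceModule.{u, v, w} k (X × Y)}
    {A : PersistenceModule.{u, v', w} k (X × Y)} (hM : M.IsAlgebraicallyWeaklyExact)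
    (i : Hom A M) (p : Hom M A) (hpi : ∀ t x, p.app t (i.app t x) = x) :
    (PersistenceModule.ker p).IsAlgebraicallyWeaklyExact := by
  refine hM.of_retract (N := PersistenceModule.ker p)
    ⟨fun t => (LinearMap.ker (p.app t)).subtype, fun _ _ => rfl⟩
    ⟨fun t => LinearMap.codRestrict _ (LinearMap.id - i.app t ∘ₗ p.app t) fun x => by simp [hpi],
      fun {s t} hst x => Subtype.ext ?_⟩ fun t x => Subtype.ext ?_
  · change M.map hst x - i.app t (p.app t (M.map hst x)) =
      M.map hst (x - i.app s (p.app s x))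
    rw [p.naturality, i.naturality, map_sub]
  · change x.1 - i.app t (p.app t x.1) = x.1
    rw [LinearMap.mem_ker.1 x.2, map_zero, sub_zero]

end Retract

/-! ### The vector and the functional that split off a rectangle -/

section Splitting

variable {k : Type u} [Field k] {X Y : Type w} [LinearOrder X] [LinearOrder Y]

/-- A normalised functional separating a vector from a subspace that does not contain it. -/
theorem _root_.Submodule.exists_dual_eq_one {V : Type*} [AddCommGroup V] [Module k V]
    {W : Submodule k V} {x : V} (hx : x ∉ W) :
    ∃ φ : V →ₗ[k] k, φ x = 1 ∧ ∀ y ∈ W, φ y = 0 := by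
  obtain ⟨φ, hφ, hW⟩ := W.exists_le_ker_of_notMem hx
  exact ⟨(φ x)⁻¹ • φ, by simp [hφ], fun y hy => by simp [LinearMap.mem_ker.1 (hW hy)]⟩

/-- If `M_a ≠ 0`, the half of weak exactness about kernels yields a vector of `M_a` whose support
is exactly a rectangle `[a,b]`. -/
theorem IsAlgebraicallyWeaklyExact.exists_vector [Finite X] [Finite Y]
    {M : PersistenceModule.{u, v, w} k (X × Y)}
    (hM : M.IsAlgebraicallyWeaklyExact) (a : X × Y) [Nontrivial (M.obj a)] :
    ∃ (b : X × Y) (hab : a ≤ b) (x : M.obj a), M.map hab x ≠ 0 ∧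
      ∀ t (h : a ≤ t), ¬ t ≤ b → M.map h x = 0 := by
  -- `b.1` is the last column reached by a nonzero map along the row of `a`
  obtain ⟨b₁, ⟨hb₁, hne₁⟩, hmax₁⟩ := wellFounded_gt.has_min
    {c : X | ∃ h : a.1 ≤ c, M.map (show a ≤ (c, a.2) from ⟨h, le_rfl⟩) ≠ 0}
    ⟨a.1, le_rfl, by
      obtain ⟨x, hx⟩ := exists_ne (0 : M.obj a)
      intro h
      apply hx
      have := congrArg (fun f => f x) h
      simpa [M.map_refl a] using this⟩
  -- `b.2` is the last row of the column `b.1` reached by a nonzero map from `a`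
  obtain ⟨b₂, ⟨hb₂, hne₂⟩, hmax₂⟩ := wellFounded_gt.has_min
    {d : Y | ∃ h : a.2 ≤ d, M.map (show a ≤ (b₁, d) from ⟨hb₁, h⟩) ≠ 0} ⟨a.2, le_rfl, hne₁⟩
  have hab : a ≤ (b₁, b₂) := ⟨hb₁, hb₂⟩
  have key : ∃ x, M.map hab x ≠ 0 ∧
      ∀ d (h : a.2 ≤ d), b₂ < d → M.map (show a ≤ (a.1, d) from ⟨le_rfl, h⟩) x = 0 := by
    by_cases hd : ∃ d, b₂ < d
    -- `d` is the row just above `b.2`: a vector that dies there dies in all higher rows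
    · obtain ⟨d, hd, hdmin⟩ := wellFounded_lt.has_min {d | b₂ < d} hd
      have had : a.2 ≤ d := hb₂.trans hd.le
      have hzero : M.map (show a ≤ (b₁, d) from ⟨hb₁, had⟩) = 0 := by
        by_contra h
        exact hmax₂ d ⟨had, h⟩ hd
      by_contra! hcon
      -- otherwise both summands of `M_a = Ker ρ_a^{(b₁,a₂)} + Ker ρ_a^{(a₁,d)}` die at `b`
      have htop := (hM a (b₁, d) ⟨hb₁, had⟩).2
      rw [hzero, LinearMap.ker_zero] at htop
      apply hne₂
      rw [← LinearMap.ker_eq_top, eq_top_iff, htop]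
      refine sup_le (fun x hx => ?_) (fun x hx => ?_)
      · rw [LinearMap.mem_ker] at hx ⊢
        rw [← map_map M (show a ≤ (b₁, a.2) from ⟨hb₁, le_rfl⟩)
          (show ((b₁, a.2) : X × Y) ≤ (b₁, b₂) from ⟨le_rfl, hb₂⟩), hx, map_zero]
      · rw [LinearMap.mem_ker] at hx ⊢
        by_contra hne
        obtain ⟨e, hae, hbe, he⟩ := hcon x hne
        apply he
        have hde : d ≤ e := not_lt.1 (hdmin e hbe)
        rw [← map_map M (show a ≤ (a.1, d) from ⟨le_rfl, had⟩)
          (show ((a.1, d) : X × Y) ≤ (a.1, e) from ⟨le_rfl, hde⟩), hx, map_zero]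
    · obtain ⟨x, hx⟩ : ∃ x, M.map hab x ≠ 0 := by
        by_contra! h
        exact hne₂ (LinearMap.ext h)
      exact ⟨x, hx, fun d _ h => absurd ⟨d, h⟩ hd⟩
  obtain ⟨x, hx, hx0⟩ := key
  refine ⟨(b₁, b₂), hab, x, hx, fun t hat htb => ?_⟩
  by_cases h₁ : t.1 ≤ b₁
  · have h₂ : b₂ < t.2 := not_le.1 fun h => htb ⟨h₁, h⟩
    rw [← map_map M (show a ≤ (a.1, t.2) from ⟨le_rfl, hat.2⟩)
      (show ((a.1, t.2) : X × Y) ≤ t from ⟨hat.1, le_rfl⟩), hx0 _ hat.2 h₂, map_zero]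
  · have hz : M.map (show a ≤ (t.1, a.2) from ⟨hat.1, le_rfl⟩) = 0 := by
      by_contra h
      exact hmax₁ t.1 ⟨hat.1, h⟩ (not_le.1 h₁)
    rw [← map_map M (show a ≤ (t.1, a.2) from ⟨hat.1, le_rfl⟩)
      (show ((t.1, a.2) : X × Y) ≤ t from ⟨le_rfl, hat.2⟩), hz, LinearMap.zero_apply, map_zero]

/-- If `M` vanishes in the rows below `a` and to the left of `a` in its row, the half of weak
exactness about images separates the nonzero image in `M_b` of a vector of `M_a` from all that
comes from outside `[a,b]`. -/
theorem IsAlgebraicallyWeaklyExact.exists_functional [Finite X]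
    {M : PersistenceModule.{u, v, w} k (X × Y)} (hM : M.IsAlgebraicallyWeaklyExact)
    {a b : X × Y} (hab : a ≤ b) (hbelow : ∀ c : X × Y, c.2 < a.2 → Subsingleton (M.obj c))
    (hleft : ∀ c < a.1, Subsingleton (M.obj (c, a.2))) {x : M.obj a} (hx : M.map hab x ≠ 0) :
    ∃ φ : M.obj b →ₗ[k] k, φ (M.map hab x) = 1 ∧
      ∀ t (h : t ≤ b), ¬ a ≤ t → ∀ y, φ (M.map h y) = 0 := by
  have key : ∃ φ : M.obj b →ₗ[k] k, φ (M.map hab x) = 1 ∧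
      ∀ c (h : c < a.1) y,
        φ (M.map (show (c, b.2) ≤ b from ⟨h.le.trans hab.1, le_rfl⟩) y) = 0 := by
    by_cases hc : ∃ c, c < a.1
    -- `c` is the column just left of `a`: images from further left factor through it
    · obtain ⟨c, hc, hcmax⟩ := wellFounded_gt.has_min {c | c < a.1} hc
      have hcb : c ≤ b.1 := hc.le.trans hab.1
      have hnot : M.map hab x ∉
          LinearMap.range (M.map (show (c, b.2) ≤ b from ⟨hcb, le_rfl⟩)) := by
        intro hmem
        have hmem' : M.map hab x ∈
            LinearMap.range (M.map (show (c, a.2) ≤ b from ⟨hcb, hab.2⟩)) := by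
          rw [(hM (c, a.2) b ⟨hcb, hab.2⟩).1]
          exact ⟨⟨M.map (show a ≤ (b.1, a.2) from ⟨hab.1, le_rfl⟩) x, map_map ..⟩, hmem⟩
        obtain ⟨y, hy⟩ := hmem'
        have := hleft c hc
        rw [Subsingleton.elim y 0, map_zero] at hy
        exact hx hy.symm
      obtain ⟨φ, hφ1, hφ0⟩ := Submodule.exists_dual_eq_one hnot
      refine ⟨φ, hφ1, fun d hd y => hφ0 _ ?_⟩
      have hdc : d ≤ c := not_lt.1 (hcmax d hd)
      exact ⟨M.map (show (d, b.2) ≤ (c, b.2) from ⟨hdc, le_rfl⟩) y, map_map ..⟩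
    · obtain ⟨φ, hφ1, -⟩ := Submodule.exists_dual_eq_one
        (W := (⊥ : Submodule k (M.obj b))) (x := M.map hab x) (by simpa using hx)
      exact ⟨φ, hφ1, fun c h => absurd ⟨c, h⟩ hc⟩
  obtain ⟨φ, hφ1, hφ0⟩ := key
  refine ⟨φ, hφ1, fun t htb hat y => ?_⟩
  by_cases h₂ : a.2 ≤ t.2
  · have h₁ : t.1 < a.1 := not_le.1 fun h => hat ⟨h, h₂⟩
    have := hφ0 t.1 h₁ (M.map (show t ≤ (t.1, b.2) from ⟨le_rfl, htb.2⟩) y)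
    rwa [map_map] at this
  · have := hbelow t (not_le.1 h₂)
    rw [Subsingleton.elim y 0, map_zero, map_zero]

/-- A nonzero module over a finite grid has a bottom-left corner: a point `a` of the lowest row
meeting the support, leftmost in that row. -/
theorem exists_corner [Finite X] [Finite Y] (M : PersistenceModule.{u, v, w} k (X × Y))
    (h : ∃ t, Nontrivial (M.obj t)) :
    ∃ a : X × Y, Nontrivial (M.obj a) ∧ (∀ c : X × Y, c.2 < a.2 → Subsingleton (M.obj c)) ∧
      ∀ c < a.1, Subsingleton (M.obj (c, a.2)) := by
  obtain ⟨⟨t₁, t₂⟩, ht⟩ := h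
  obtain ⟨a₂, ⟨c, hc⟩, hmin₂⟩ := wellFounded_lt.has_min
    {d : Y | ∃ c : X, Nontrivial (M.obj (c, d))} ⟨t₂, t₁, ht⟩
  obtain ⟨a₁, ha, hmin₁⟩ := wellFounded_lt.has_min
    {c : X | Nontrivial (M.obj (c, a₂))} ⟨c, hc⟩
  refine ⟨(a₁, a₂), ha, fun c hc => ?_, fun c hc => ?_⟩
  · exact not_nontrivial_iff_subsingleton.1 fun h => hmin₂ c.2 ⟨c.1, h⟩ hc
  · exact not_nontrivial_iff_subsingleton.1 fun h => hmin₁ c h hc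

end Splitting

end PersistenceModule

open PersistenceModule

/-! ### Direct sums of rectangle modules -/

section Rectangles

variable {k : Type u} [Field k] {X Y : Type w} [LinearOrder X] [LinearOrder Y]

theorem isRectangle_Icc {a b : X × Y} (hab : a ≤ b) : IsRectangle (Set.Icc a b) :=
  ⟨Set.Icc a.1 b.1, Set.Icc a.2 b.2, ⟨a.1, le_rfl, hab.1⟩, Set.ordConnected_Icc,
    ⟨a.2, le_rfl, hab.2⟩, Set.ordConnected_Icc, (Set.Icc_prod_eq a b)⟩

/-- In a finite grid every rectangle is an interval `[a,b]` of the product order. -/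
theorem IsRectangle.exists_eq_Icc [Finite X] [Finite Y] {R : Set (X × Y)} (hR : IsRectangle R) :
    ∃ a b : X × Y, a ≤ b ∧ R = Set.Icc a b := by
  have aux : ∀ {Z : Type w} [LinearOrder Z] [Finite Z] {I : Set Z}, I.Nonempty →
      I.OrdConnected → ∃ c d : Z, c ≤ d ∧ I = Set.Icc c d := by
    intro Z _ _ I hne hI
    obtain ⟨c, hc, hcmin⟩ := wellFounded_lt.has_min I hne
    obtain ⟨d, hd, hdmax⟩ := wellFounded_gt.has_min I hne
    refine ⟨c, d, not_lt.1 (hcmin d hd), Set.Subset.antisymm (fun x hx => ?_) (hI.out hc hd)⟩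
    exact ⟨not_lt.1 (hcmin x hx), not_lt.1 (hdmax x hx)⟩
  obtain ⟨I, J, hIne, hI, hJne, hJ, rfl⟩ := hR
  obtain ⟨c, d, hcd, rfl⟩ := aux hIne hI
  obtain ⟨e, f, hef, rfl⟩ := aux hJne hJ
  exact ⟨(c, e), (d, f), ⟨hcd, hef⟩, Set.Icc_prod_Icc c d e f⟩

theorem rectangleSum_cons (R : Rectangle X Y) (𝓡 : Multiset (Rectangle X Y)) :
    (rectangleSum k (R ::ₘ 𝓡)).IsIsomorphic ((rectangleModule k R).prod (rectangleSum k 𝓡)) := by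
  classical
  exact (directSum_reindex (Multiset.consEquiv (v := R) (m := 𝓡))
    fun i : (R ::ₘ 𝓡).ToType => rectangleModule k i.1).trans (directSum_option _)

theorem subsingleton_rectangleSum_zero (t : X × Y) :
    Subsingleton ((rectangleSum k (0 : Multiset (Rectangle X Y))).obj t) := by
  classical
  refine ⟨fun x y => DFinsupp.ext fun i => ?_⟩
  exact isEmptyElim (α := (0 : Multiset (Rectangle X Y)).ToType) i

theorem rectangleSum_isPFD (𝓡 : Multiset (Rectangle X Y)) : (rectangleSum k 𝓡).IsPFD := by
  induction 𝓡 using Multiset.induction_on with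
  | empty =>
    intro t
    have := subsingleton_rectangleSum_zero (k := k) t
    infer_instance
  | cons R 𝓡 ih =>
    refine (rectangleSum_cons R 𝓡).symm.isPFD fun t => ?_
    have := ih t
    have : FiniteDimensional k ((rectangleModule k R).obj t) :=
      indicator_isPFD R.2.ordConnected t
    exact inferInstanceAs
      (FiniteDimensional k ((rectangleModule k R).obj t × (rectangleSum k 𝓡).obj t))

open Classical in
/-- The rank of `ρ_s^t` counts, with multiplicity, the rectangles that contain both `s` and `t`. -/
theorem finrank_range_rectangleSum (𝓡 : Multiset (Rectangle X Y)) {s t : X × Y} (hst : s ≤ t) :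
    Module.finrank k (LinearMap.range ((rectangleSum k 𝓡).map hst)) =
      𝓡.countP fun R => s ∈ R.1 ∧ t ∈ R.1 := by
  induction 𝓡 using Multiset.induction_on with
  | empty =>
    have := subsingleton_rectangleSum_zero (k := k) t
    rw [Multiset.countP_zero, Module.finrank_zero_of_subsingleton]
  | cons R 𝓡 ih =>
    rw [(rectangleSum_cons R 𝓡).finrank_range_eq hst,
      finrank_range_prod (M := rectangleModule k R) (indicator_isPFD _) (rectangleSum_isPFD 𝓡) hst,
      ih,
      Multiset.countP_cons, add_comm]
    congr 1
    exact finrank_range_indicator R.2.ordConnected hst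

end Rectangles

/-! ### Recovering a multiset from counts of upper sets -/

open Classical in
/-- Möbius inversion for multisets: in a finite partial order a multiset is determined by the
number of its members above each element. -/
theorem Multiset.eq_of_countP_le_eq {α : Type*} [PartialOrder α] [Finite α] {A B : Multiset α}
    (h : ∀ a, A.countP (a ≤ ·) = B.countP (a ≤ ·)) : A = B := by
  ext a
  induction a using (wellFounded_gt (α := α)).induction with
  | _ a ih =>
  have split : ∀ C : Multiset α, C.countP (a ≤ ·) = C.count a + C.countP (a < ·) := by
    intro C
    induction C using Multiset.induction_on with
    | empty => simp
    | cons c C ihC =>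
      rw [Multiset.countP_cons, Multiset.countP_cons, Multiset.count_cons, ihC]
      rcases eq_or_ne a c with rfl | hne
      · simp; omega
      · simp [hne, le_iff_lt_or_eq]; omega
  have hfilter : A.filter (a < ·) = B.filter (a < ·) := by
    ext b
    by_cases hb : a < b
    · rw [Multiset.count_filter_of_pos hb, Multiset.count_filter_of_pos hb, ih b hb]
    · rw [Multiset.count_filter_of_neg hb, Multiset.count_filter_of_neg hb]
  have ha := h a
  rw [split, split, Multiset.countP_eq_card_filter, Multiset.countP_eq_card_filter, hfilter] at ha
  exact Nat.add_right_cancel ha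

/-! ### The decomposition and its uniqueness -/

section Decomposition

variable {k : Type u} [Field k] {X Y : Type w} [LinearOrder X] [LinearOrder Y]

theorem eq_of_rectangleSum_isIsomorphic [Finite X] [Finite Y] {𝓡 𝓢 : Multiset (Rectangle X Y)}
    (h : (rectangleSum k 𝓡).IsIsomorphic (rectangleSum k 𝓢)) : 𝓡 = 𝓢 := by
  classical
  refine Multiset.eq_of_countP_le_eq fun R => ?_
  obtain ⟨a, b, hab, hR⟩ := R.2.exists_eq_Icc
  have hiff : ∀ S : Rectangle X Y, R ≤ S ↔ a ∈ S.1 ∧ b ∈ S.1 := by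
    intro S
    rw [← Subtype.coe_le_coe, hR]
    exact ⟨fun h => ⟨h ⟨le_rfl, hab⟩, h ⟨hab, le_rfl⟩⟩,
      fun h => S.2.ordConnected.out h.1 h.2⟩
  have hrank := h.finrank_range_eq hab
  rw [finrank_range_rectangleSum, finrank_range_rectangleSum] at hrank
  simpa only [hiff] using hrank

/-- The inductive step: a nonzero weakly exact module is the direct sum of a rectangle module and
a weakly exact module of smaller dimension. -/
theorem PersistenceModule.IsAlgebraicallyWeaklyExact.exists_split [Finite X] [Finite Y]
    {M : PersistenceModule.{u, v, w} k (X × Y)} (hM : M.IsAlgebraicallyWeaklyExact)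
    (hne : ∃ t, Nontrivial (M.obj t)) :
    ∃ (R : Rectangle X Y) (p : Hom M (rectangleModule k R)),
      M.IsIsomorphic ((rectangleModule k R).prod (PersistenceModule.ker p)) ∧
      (PersistenceModule.ker p).IsAlgebraicallyWeaklyExact ∧
      ∃ a, LinearMap.ker (p.app a) < ⊤ := by
  obtain ⟨a, ha, hbelow, hleft⟩ := M.exists_corner hne
  obtain ⟨b, hab, x, hx, hx0⟩ := hM.exists_vector a
  obtain ⟨φ, hφ1, hφ0⟩ := hM.exists_functional hab hbelow hleft hx
  have hpi := homToIndicator_homOfVector M hab x hx0 φ hφ0 hφ1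
  refine ⟨⟨Set.Icc a b, isRectangle_Icc hab⟩, homToIndicator M φ hφ0,
    isIsomorphic_prod_ker (homOfVector M x hx0) _ hpi, hM.ker (homOfVector M x hx0) _ hpi,
    a, lt_top_iff_ne_top.2 fun htop => ?_⟩
  have hmem : x ∈ LinearMap.ker ((homToIndicator M φ hφ0).app a) := htop ▸ Submodule.mem_top
  have h1 := indicatorVal_homToIndicator M φ hφ0 hab x
  rw [LinearMap.mem_ker.1 hmem, map_zero, hφ1] at h1
  exact zero_ne_one h1

theorem PersistenceModule.IsAlgebraicallyWeaklyExact.exists_rectangleSum [Finite X] [Finite Y]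
    {M : PersistenceModule.{u, v, w} k (X × Y)} (hM : M.IsAlgebraicallyWeaklyExact)
    (hfin : M.IsPFD) : ∃ 𝓡 : Multiset (Rectangle X Y), M.IsIsomorphic (rectangleSum k 𝓡) := by
  have := Fintype.ofFinite (X × Y)
  induction hn : ∑ t, Module.finrank k (M.obj t) using Nat.strong_induction_on generalizing M with
  | _ n ih =>
  by_cases hne : ∃ t, Nontrivial (M.obj t)
  · obtain ⟨R, p, hiso, hker, a, ha⟩ := hM.exists_split hne
    have hkerfin : (PersistenceModule.ker p).IsPFD := fun t =>
      have := hfin t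
      inferInstanceAs (FiniteDimensional k (LinearMap.ker (p.app t)))
    have hlt : ∑ t, Module.finrank k ((PersistenceModule.ker p).obj t) < n := by
      rw [← hn]
      refine Finset.sum_lt_sum (fun t _ => ?_) ⟨a, Finset.mem_univ a, ?_⟩
      · have := hfin t
        exact Submodule.finrank_le (LinearMap.ker (p.app t))
      · have := hfin a
        exact Submodule.finrank_lt ha.ne
    obtain ⟨𝓡, h𝓡⟩ := ih _ hlt hker hkerfin rfl
    exact ⟨R ::ₘ 𝓡, (hiso.trans (h𝓡.prod_right _)).trans (rectangleSum_cons R 𝓡).symm⟩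
  · refine ⟨0, fun t => ?_, fun {s t} hst x => ?_⟩
    · have := subsingleton_rectangleSum_zero (k := k) t
      have := not_nontrivial_iff_subsingleton.1 fun h => hne ⟨t, h⟩
      exact LinearEquiv.ofSubsingleton _ _
    · have := subsingleton_rectangleSum_zero (k := k) t
      exact Subsingleton.elim _ _

end Decomposition

theorem mainTheorem2 {k : Type u} [Field k] (X Y : Finset ℝ)
    (M : PersistenceModule.{u, v, 0} k (X × Y)) (hfin : M.IsPFD)
    (hM : M.IsAlgebraicallyWeaklyExact) :
    ∃! 𝓡 : Multiset (Rectangle X Y), M.IsIsomorphic (rectangleSum k 𝓡) := by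
  obtain ⟨𝓡, h𝓡⟩ := hM.exists_rectangleSum hfin
  exact ⟨𝓡, h𝓡, fun 𝓢 h𝓢 => eq_of_rectangleSum_isIsomorphic (h𝓢.symm.trans h𝓡)⟩
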